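/- Let $f_n:\{0,1\}^n\times\{0,1\}^n\to\{0,1\}$ be chosen uniformly at random among all such functions. Then, with probability $1-o(1)$ as $n\to\infty$, $$C_{\mathrm{clean}}(f_n)\;\ge\; 2n-2\log_2(n+1)-7 .$$ Here $C_{\mathrm{clean}}(f)$ is the minimum, over all clean classical protocols computing $f$ exactly, of the total number of bits exchanged (in both directions). A clean classical protocol for $f$ is a two-party protocol on one-bit registers of the following form. Initially Alice holds $n$ registers containing her input $x$ together with any number of ancilla registers containing $0$, and Bob holds $n$ registers containing his input $y$, any number of ancilla registers containing $0$, and an answer register containing $z\in\{0,1\}$. The players take turns; in each turn a player applies a reversible transformation (a bijection) to the joint content of the registers in their possession and then sends some subset of these registers to the other player. For all $x,y\in\{0,1\}^n$ and $z\in\{0,1\}$, at the end of the protocol the answer register contains $z\oplus f(x,y)$ and is held by Bob, all input registers are with their original holder and contain $x$ and $y$ as before, and all ancilla registers contain $0$. -/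

import Mathlib

namespace CleanComm

/-- The two parties. -/
inductive Player where
  | alice
  | bob
  deriving DecidableEq

/-- The other party. -/
def Player.other : Player → Player
  | .alice => .bob
  | .bob => .alice

/-- The one-bit registers present in a protocol on `n`-bit inputs in which Alice starts with `k`
ancilla bits and Bob with `l`: Alice's input, Bob's input, the two groups of ancillas, and the
answer register. -/
inductive Reg (n k l : ℕ) where
  | inA (i : Fin n)
  | inB (i : Fin n)
  | ancA (i : Fin k)
  | ancB (i : Fin l)
  | ans
  deriving DecidableEq

/-- Who holds each register at the beginning; the answer register is held by Bob. -/
def initOwner (n k l : ℕ) : Reg n k l → Player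
  | .inA _ => .alice
  | .ancA _ => .alice
  | .inB _ => .bob
  | .ancB _ => .bob
  | .ans => .bob

/-- The joint content of the registers in which the input registers hold `x` and `y`, all ancillas
are zero, and the answer register holds `z`. -/
def config {n k l : ℕ} (x y : Fin n → Bool) (z : Bool) : Reg n k l → Bool
  | .inA i => x i
  | .inB i => y i
  | .ancA _ => false
  | .ancB _ => false
  | .ans => z

variable {W : Type} [DecidableEq W]

/-- Ownership after the registers in `sent` have been handed over to player `q`. -/
def transfer (own : W → Player) (sent : Finset W) (q : Player) : W → Player :=
  fun w => if w ∈ sent then q else own w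

/-- Apply a transformation of the contents of the registers held by `p`, leaving all others
untouched. -/
def applyLocal (own : W → Player) (p : Player)
    (op : Equiv.Perm ({w : W // own w = p} → Bool)) (s : W → Bool) : W → Bool :=
  fun w => if h : own w = p then op (fun v => s v) ⟨w, h⟩ else s w

/-- A reversible classical two-party protocol on the one-bit registers `W`, started with ownership
`own`. In each turn a player applies a reversible transformation to the joint content of the
registers in their possession and then sends a subset of these registers to the other player.
The subset may be empty, so nothing is lost or gained by not imposing strict alternation. -/
inductive Protocol (W : Type) [DecidableEq W] : (W → Player) → Type
  | done {own : W → Player} : Protocol W own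
  | turn {own : W → Player} (p : Player) (op : Equiv.Perm ({w : W // own w = p} → Bool))
      (sent : Finset W) (hsent : ∀ w ∈ sent, own w = p)
      (rest : Protocol W (transfer own sent p.other)) : Protocol W own

namespace Protocol

/-- The final content of the registers when the protocol is run on initial content `s`. -/
def run : {own : W → Player} → Protocol W own → (W → Bool) → (W → Bool)
  | _, .done, s => s
  | own, .turn p op _ _ rest, s => rest.run (applyLocal own p op s)

/-- Who holds each register at the end of the protocol. -/
def finalOwner : {own : W → Player} → Protocol W own → (W → Player)
  | own, .done => own
  | _, .turn _ _ _ _ rest => rest.finalOwner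

/-- The total number of bits exchanged, in both directions. -/
def cost : {own : W → Player} → Protocol W own → ℕ
  | _, .done => 0
  | _, .turn _ _ sent _ rest => sent.card + rest.cost

/-- The protocol computes `f` exactly and cleanly: on all inputs and for both initial values of the
answer register, it adds `f x y` modulo 2 to the answer register and returns every other register to
its initial content; at the end Alice holds her input, Bob holds his input and the answer register.
(An ancilla bit must be returned to zero, but may end up with either player.) -/
structure CleanlyComputes {n k l : ℕ} (P : Protocol (Reg n k l) (initOwner n k l))
    (f : (Fin n → Bool) → (Fin n → Bool) → Bool) : Prop where
  run_eq : ∀ x y z, P.run (config x y z) = config x y (xor z (f x y))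
  owner_inA : ∀ i, P.finalOwner (.inA i) = .alice
  owner_inB : ∀ i, P.finalOwner (.inB i) = .bob
  owner_ans : P.finalOwner .ans = .bob

end Protocol

/-- The clean classical communication complexity of `f`: the least number of bits exchanged by a
protocol, with any numbers of ancilla bits, that cleanly computes `f`. -/
noncomputable def cleanCC {n : ℕ} (f : (Fin n → Bool) → (Fin n → Bool) → Bool) : ℕ :=
  sInf {c : ℕ | ∃ (k l : ℕ) (P : Protocol (Reg n k l) (initOwner n k l)),
    P.CleanlyComputes f ∧ P.cost = c}

end CleanComm

/-! ### Local transformations and ownership -/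

namespace CleanComm

/-! Record a run by the pair of bit strings that the players send. Fix `x` and the answer bit 0:
over all `y`, Alice starts and, by cleanness, ends with fixed local content. Run forwards, the bits
she receives determine the transcript; run backwards, by reversibility, the bits she sends do. So
the number of transcripts is at most 2 to the power of the smaller one-way cost, hence of half the
total cost (`card_transcripts_le`). For Bob the same holds once only the `x` with `f x y = true` are
kept, which fixes his final answer bit.

By the rectangle property (`run_eq_of_messages_eq`), `f x y = true` exactly when these two sets of
transcripts meet (`exists_families`). A cheap function is thus encoded by two families of small sets
of labels, and such codes are too few to cover more than a fraction `2⁻ⁿ` of all functions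
(`card_codes_mul_le`). -/

theorem Player.eq_or_eq_other (p q : Player) : q = p ∨ q = p.other := by
  cases p <;> cases q <;> simp [Player.other]

theorem Player.other_ne (p : Player) : p.other ≠ p := by
  cases p <;> simp [Player.other]

theorem applyLocal_of_ne {W : Type} {own : W → Player} {p : Player}
    (op : Equiv.Perm ({w : W // own w = p} → Bool)) (s : W → Bool) {w : W} (h : own w ≠ p) :
    applyLocal own p op s w = s w := by
  simp [applyLocal, h]

theorem applyLocal_congr {W : Type} {own : W → Player} {p : Player}
    (op : Equiv.Perm ({w : W // own w = p} → Bool)) {s t : W → Bool}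
    (hst : ∀ w, own w = p → s w = t w) {w : W} (h : own w = p) :
    applyLocal own p op s w = applyLocal own p op t w := by
  have : (fun v : {w : W // own w = p} => s v) = fun v : {w : W // own w = p} => t v :=
    funext fun v => hst v v.2
  simp [applyLocal, h, this]

theorem applyLocal_inj {W : Type} {own : W → Player} {p : Player}
    (op : Equiv.Perm ({w : W // own w = p} → Bool)) {s t : W → Bool}
    (hst : ∀ w, own w = p → applyLocal own p op s w = applyLocal own p op t w) {w : W}
    (h : own w = p) : s w = t w := by
  have : op (fun v => s v) = op fun v => t v := by
    funext v
    have := hst v v.2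
    simpa [applyLocal, v.2] using this
  exact congrFun (op.injective this) ⟨w, h⟩

/-! ### Transcripts and the rectangle property -/

namespace Protocol

variable {W : Type} [DecidableEq W]

/-- The number of bits sent by `q`. -/
def costBy (q : Player) : {own : W → Player} → Protocol W own → ℕ
  | _, .done => 0
  | _, .turn p _ sent _ rest => (if p = q then sent.card else 0) + rest.costBy q

/-- The bits sent by `q` when the protocol is run on initial content `s`. -/
noncomputable def messages (q : Player) : {own : W → Player} → Protocol W own → (W → Bool) → List Bool
  | _, .done, _ => []
  | own, .turn p op sent _ rest, s =>
    (if p = q then sent.toList.map (applyLocal own p op s) else []) ++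
      rest.messages q (applyLocal own p op s)

theorem cost_eq_add {own : W → Player} (P : Protocol W own) :
    P.cost = P.costBy .alice + P.costBy .bob := by
  induction P with
  | done => rfl
  | turn p op sent hsent rest ih => cases p <;> simp [cost, costBy, ih] <;> omega

theorem length_messages (q : Player) {own : W → Player} (P : Protocol W own) (s : W → Bool) :
    (P.messages q s).length = P.costBy q := by
  induction P generalizing s with
  | done => rfl
  | turn p op sent hsent rest ih =>
    by_cases h : p = q <;> simp [messages, costBy, ih, h]

theorem messages_turn_eq {own : W → Player} {p q : Player}
    {op : Equiv.Perm ({w : W // own w = p} → Bool)} {sent : Finset W}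
    {hsent : ∀ w ∈ sent, own w = p} {rest : Protocol W (transfer own sent p.other)}
    {s t : W → Bool} :
    (turn p op sent hsent rest).messages q s = (turn p op sent hsent rest).messages q t ↔
      (p = q → ∀ w ∈ sent, applyLocal own p op s w = applyLocal own p op t w) ∧
      rest.messages q (applyLocal own p op s) = rest.messages q (applyLocal own p op t) := by
  by_cases h : p = q
  · simp only [messages, h, if_true, forall_const]
    constructor
    · intro e
      obtain ⟨e₁, e₂⟩ := List.append_inj e (by simp)
      exact ⟨fun w hw => List.map_inj_left.1 e₁ w (Finset.mem_toList.2 hw), e₂⟩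
    · rintro ⟨e₁, e₂⟩
      rw [e₂, List.map_inj_left.2 fun w hw => e₁ w (Finset.mem_toList.1 hw)]
  · simp [messages, h]

/-- A player's view is determined by the initial local content and the bits received. -/
theorem messages_eq_of_received {own : W → Player} (P : Protocol W own) (p : Player)
    {s t : W → Bool} (hst : ∀ w, own w = p → s w = t w)
    (hm : P.messages p.other s = P.messages p.other t) :
    P.messages p s = P.messages p t := by
  induction P generalizing s t with
  | done => rfl
  | @turn own q op sent hsent rest ih =>
    rw [messages_turn_eq] at hm ⊢
    obtain ⟨hm₁, hm₂⟩ := hm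
    rcases p.eq_or_eq_other q with rfl | rfl
    · have h := fun w => applyLocal_congr op hst (w := w)
      refine ⟨fun _ w hw => h w (hsent w hw), ih (fun w hw => ?_) hm₂⟩
      by_cases hs : w ∈ sent
      · exact h w (hsent w hs)
      · simp only [transfer, hs, if_false] at hw
        exact h w hw
    · refine ⟨fun e => absurd e p.other_ne, ih (fun w hw => ?_) hm₂⟩
      by_cases hs : w ∈ sent
      · exact hm₁ rfl w hs
      · simp only [transfer, hs, if_false] at hw
        have hne : own w ≠ p.other := fun e => p.other_ne (e.symm.trans hw)
        rw [applyLocal_of_ne op s hne, applyLocal_of_ne op t hne]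
        exact hst w hw

/-- Running backwards, a player's view is determined by the final local content and the bits
sent. -/
theorem messages_eq_of_sent {own : W → Player} (P : Protocol W own) (p : Player)
    {s t : W → Bool} (hst : ∀ w, P.finalOwner w = p → P.run s w = P.run t w)
    (hm : P.messages p s = P.messages p t) :
    (∀ w, own w = p → s w = t w) ∧ P.messages p.other s = P.messages p.other t := by
  induction P generalizing s t with
  | done => exact ⟨hst, rfl⟩
  | @turn own q op sent hsent rest ih =>
    rw [messages_turn_eq] at hm ⊢
    obtain ⟨hm₁, hm₂⟩ := hm
    obtain ⟨hown, hrest⟩ := ih hst hm₂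
    rcases p.eq_or_eq_other q with rfl | rfl
    · refine ⟨fun w hw => applyLocal_inj op (fun v hv => ?_) hw,
        fun e => absurd e.symm q.other_ne, hrest⟩
      by_cases hs : v ∈ sent
      · exact hm₁ rfl v hs
      · exact hown v (by simpa only [transfer, hs, if_false] using hv)
    · refine ⟨fun w hw => ?_, fun _ w hw => ?_, hrest⟩
      · have hne : own w ≠ p.other := fun e => p.other_ne (e.symm.trans hw)
        have hs : w ∉ sent := fun hs => hne (hsent w hs)
        have := hown w (by simpa only [transfer, hs, if_false] using hw)
        rwa [applyLocal_of_ne op s hne, applyLocal_of_ne op t hne] at this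
      · refine hown w ?_
        simp only [transfer, hw, if_true]
        cases p <;> rfl

/-- The runs with a given transcript form a rectangle. -/
theorem run_eq_of_messages_eq {own : W → Player} (P : Protocol W own) {s : W → Bool}
    {S : Player → W → Bool} (hs : ∀ w, s w = S (own w) w)
    (hm : ∀ q, P.messages q (S .alice) = P.messages q (S .bob)) (w : W) :
    P.run s w = P.run (S (P.finalOwner w)) w := by
  induction P generalizing s S with
  | done => exact hs w
  | @turn own p op sent hsent rest ih =>
    simp only [messages_turn_eq] at hm
    have hloc : ∀ v, applyLocal own p op s v = applyLocal own p op (S (own v)) v := by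
      intro v
      by_cases h : own v = p
      · rw [h]
        exact applyLocal_congr op (fun u hu => by rw [hs, hu]) h
      · rw [applyLocal_of_ne op _ h, applyLocal_of_ne op _ h, hs]
    -- The value of a register that changes hands is part of the transcript, so both runs agree on
    -- it and the gluing survives the transfer.
    have hsame : ∀ v ∈ sent, ∀ q r,
        applyLocal own p op (S q) v = applyLocal own p op (S r) v := by
      intro v hv q r
      have := (hm p).1 rfl v hv
      cases q <;> cases r <;> simp [this]
    refine ih (S := fun q => applyLocal own p op (S q)) (fun v => ?_) fun q => (hm q).2
    rw [hloc v]
    by_cases hv : v ∈ sent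
    · exact hsame v hv _ _
    · simp only [transfer, hv, if_false]

/-- The pair of bit strings sent by the two players. -/
noncomputable def transcript {own : W → Player} (P : Protocol W own) (s : W → Bool) :
    List.Vector Bool (P.costBy .alice) × List.Vector Bool (P.costBy .bob) :=
  (⟨P.messages .alice s, P.length_messages _ s⟩, ⟨P.messages .bob s, P.length_messages _ s⟩)

theorem transcript_eq_iff {own : W → Player} (P : Protocol W own) {s t : W → Bool} :
    P.transcript s = P.transcript t ↔ ∀ q, P.messages q s = P.messages q t := by
  refine ⟨fun h q => ?_, fun h => Prod.ext (Subtype.ext (h _)) (Subtype.ext (h _))⟩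
  cases q
  exacts [congrArg (fun τ => τ.1.1) h, congrArg (fun τ => τ.2.1) h]

/-- Runs in which some player starts with a fixed local content and ends with a fixed local content
realise at most as many transcripts as either player has strings to send. -/
theorem card_transcripts_le {own : W → Player} (P : Protocol W own) (p : Player)
    {ι : Type*} [DecidableEq ι] (I : Finset ι) (s : ι → W → Bool)
    (hinit : ∀ i ∈ I, ∀ j ∈ I, ∀ w, own w = p → s i w = s j w)
    (hfinal : ∀ i ∈ I, ∀ j ∈ I, ∀ w, P.finalOwner w = p → P.run (s i) w = P.run (s j) w)
    (q : Player) : (I.image fun i => P.transcript (s i)).card ≤ 2 ^ P.costBy q := by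
  have key : ∀ i ∈ I, ∀ j ∈ I, P.messages q (s i) = P.messages q (s j) →
      P.transcript (s i) = P.transcript (s j) := by
    intro i hi j hj h
    rw [transcript_eq_iff]
    have hp : P.messages p (s i) = P.messages p (s j) ∧
        P.messages p.other (s i) = P.messages p.other (s j) := by
      rcases p.eq_or_eq_other q with rfl | rfl
      · exact ⟨h, (P.messages_eq_of_sent q (hfinal i hi j hj) h).2⟩
      · exact ⟨P.messages_eq_of_received p (hinit i hi j hj) h, h⟩
    intro r
    rcases p.eq_or_eq_other r with rfl | rfl
    exacts [hp.1, hp.2]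
  have hcard : (Finset.univ : Finset (List.Vector Bool (P.costBy q))).card = 2 ^ P.costBy q := by
    rw [Finset.card_univ, card_vector, Fintype.card_bool]
  rw [← hcard]
  refine Finset.card_le_card_of_surjOn
    -- Strings that no run in `I` sends get an arbitrary transcript; only surjectivity onto the
    -- image matters.
    (fun v => if h : ∃ i ∈ I, P.messages q (s i) = v.1 then P.transcript (s h.choose)
      else P.transcript fun _ => false) ?_
  intro τ hτ
  obtain ⟨i, hi, rfl⟩ := Finset.mem_image.1 (Finset.mem_coe.1 hτ)
  refine ⟨⟨P.messages q (s i), P.length_messages _ _⟩, Finset.mem_coe.2 (Finset.mem_univ _), ?_⟩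
  have h : ∃ j ∈ I, P.messages q (s j) = P.messages q (s i) := ⟨i, hi, rfl⟩
  simp only [h, dif_pos]
  exact key _ h.choose_spec.1 _ hi h.choose_spec.2

/-- A function with a clean protocol is the incidence relation of two families of small sets of
transcripts. -/
theorem CleanlyComputes.exists_families {n k l : ℕ} {P : Protocol (Reg n k l) (initOwner n k l)}
    {f : (Fin n → Bool) → (Fin n → Bool) → Bool} (hP : P.CleanlyComputes f) :
    ∃ A B : (Fin n → Bool) →
        Finset (List.Vector Bool (P.costBy .alice) × List.Vector Bool (P.costBy .bob)),
      (∀ x q, (A x).card ≤ 2 ^ P.costBy q) ∧ (∀ y q, (B y).card ≤ 2 ^ P.costBy q) ∧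
      ∀ x y, f x y = true ↔ ∃ τ, τ ∈ A x ∧ τ ∈ B y := by
  refine ⟨fun x => Finset.univ.image fun y => P.transcript (config x y false),
    fun y => (Finset.univ.filter fun x => f x y = true).image
      fun x => P.transcript (config x y false), ?_, ?_, ?_⟩
  · intro x q
    refine P.card_transcripts_le .alice _ (fun y => config x y false) ?_ ?_ q
    · intro y _ y' _ w hw
      cases w <;> simp_all [initOwner, config]
    · intro y _ y' _ w hw
      simp only [hP.run_eq]
      cases w <;> simp_all [config, hP.owner_inB, hP.owner_ans]
  · intro y q
    refine P.card_transcripts_le .bob _ (fun x => config x y false) ?_ ?_ q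
    · intro x _ x' _ w hw
      cases w <;> simp_all [initOwner, config]
    · intro x hx x' hx' w hw
      simp only [hP.run_eq]
      cases w <;> simp_all [config, hP.owner_inA]
  · intro x y
    constructor
    · intro h
      exact ⟨P.transcript (config x y false), Finset.mem_image_of_mem _ (Finset.mem_univ y),
        Finset.mem_image_of_mem (fun x => P.transcript (config x y false)) (by simpa using h)⟩
    · rintro ⟨τ, hA, hB⟩
      obtain ⟨y', -, rfl⟩ := Finset.mem_image.1 hA
      obtain ⟨x', hx', h⟩ := Finset.mem_image.1 hB
      -- The run on `(x, y)` glues Alice's side of `(x, y')` to Bob's side of `(x', y)`. Bob ends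
      -- with the answer register, so it shows `f x' y`, which is 1.
      have hm := (P.transcript_eq_iff).1 h.symm
      have := P.run_eq_of_messages_eq (s := config x y false)
        (S := fun q => match q with
          | .alice => config x y' false
          | .bob => config x' y false) (fun w => by cases w <;> rfl) hm .ans
      rw [hP.owner_ans, hP.run_eq] at this
      simp only [hP.run_eq] at this
      simpa [config, (Finset.mem_filter.1 hx').2] using this

end Protocol

/-! ### Attainment of the minimum -/

/-- Alice sends her input, Bob updates the answer and sends it back. This rules out the junk value
`sInf ∅ = 0` for `cleanCC`. -/
theorem exists_cleanlyComputes {n : ℕ} (f : (Fin n → Bool) → (Fin n → Bool) → Bool) :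
    ∃ P : Protocol (Reg n 0 0) (initOwner n 0 0), P.CleanlyComputes f := by
  let sent : Finset (Reg n 0 0) := Finset.univ.image Reg.inA
  let flip : (Reg n 0 0 → Bool) → Reg n 0 0 → Bool := fun s w => match w with
    | .ans => xor (s .ans) (f (fun i => s (.inA i)) fun i => s (.inB i))
    | w => s w
  have hflip : Function.Involutive flip := by
    intro s
    funext w
    cases w <;> simp [flip]
  let own := transfer (initOwner n 0 0) sent .bob
  have hown : ∀ w, own w = .bob := by
    intro w
    cases w with
    | ancA i => exact i.elim0
    | _ => simp [own, transfer, sent, initOwner]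
  let e : (Reg n 0 0 → Bool) ≃ ({w // own w = .bob} → Bool) :=
    (Equiv.subtypeUnivEquiv hown).symm.arrowCongr (Equiv.refl Bool)
  let op : Equiv.Perm ({w // own w = .bob} → Bool) := (e.symm.trans hflip.toPerm).trans e
  have hop : ∀ s, applyLocal own .bob op s = flip s := by
    intro s
    funext w
    simp only [applyLocal, hown w, dif_pos]
    rfl
  have hid : ∀ s : Reg n 0 0 → Bool,
      applyLocal (initOwner n 0 0) .alice (Equiv.refl _) s = s := by
    intro s
    funext w
    simp [applyLocal]
  refine ⟨.turn .alice (Equiv.refl _) sent (by simp [sent, initOwner])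
    (.turn .bob op sent (fun w _ => hown w) .done), ?_, ?_, ?_, ?_⟩
  · intro x y z
    change applyLocal own .bob op (applyLocal (initOwner n 0 0) .alice (Equiv.refl _) _) = _
    rw [hid, hop]
    funext w
    cases w <;> rfl
  all_goals simp [Protocol.finalOwner, transfer, sent, initOwner, Player.other]

theorem exists_protocol_cost_eq_cleanCC {n : ℕ} (f : (Fin n → Bool) → (Fin n → Bool) → Bool) :
    ∃ (k l : ℕ) (P : Protocol (Reg n k l) (initOwner n k l)),
      P.CleanlyComputes f ∧ P.cost = cleanCC f := by
  obtain ⟨P, hP⟩ := exists_cleanlyComputes f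
  exact Nat.sInf_mem (s := {c : ℕ | ∃ (k l : ℕ) (P : Protocol (Reg n k l) (initOwner n k l)),
    P.CleanlyComputes f ∧ P.cost = c}) ⟨_, 0, 0, P, hP, rfl⟩

/-! ### Encoding cheap functions and counting the codes -/

theorem exists_enumeration {σ : Type*} (s : Finset σ) {K : ℕ} (h : s.card ≤ K) :
    ∃ g : Fin K → Option σ, ∀ t, t ∈ s ↔ ∃ i, g i = some t := by
  refine ⟨fun i => s.toList[(i : ℕ)]?, fun t => ?_⟩
  rw [← Finset.mem_toList, List.mem_iff_getElem?]
  constructor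
  · rintro ⟨i, hi⟩
    have : i < s.toList.length := (List.getElem?_eq_some_iff.1 hi).1
    exact ⟨⟨i, by rw [Finset.length_toList] at this; omega⟩, hi⟩
  · rintro ⟨i, hi⟩
    exact ⟨i, hi⟩

open Classical in
/-- The relation on `X` and `Y` that two families of lists of labels define by incidence. -/
noncomputable def incidence {X : Type*} {K D : ℕ}
    (c : (X → Fin K → Option (Fin D)) × (X → Fin K → Option (Fin D))) : X → X → Bool :=
  fun x y => decide (∃ u, (∃ i, c.1 x i = some u) ∧ ∃ j, c.2 y j = some u)

theorem mem_range_incidence {X τ : Type*} [Fintype τ] {K D : ℕ} (hD : Fintype.card τ ≤ D)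
    {A B : X → Finset τ} (hA : ∀ x, (A x).card ≤ K) (hB : ∀ x, (B x).card ≤ K)
    {f : X → X → Bool} (hf : ∀ x y, f x y = true ↔ ∃ t, t ∈ A x ∧ t ∈ B y) :
    f ∈ Set.range (incidence (X := X) (K := K) (D := D)) := by
  obtain ⟨φ⟩ : Nonempty (τ ↪ Fin D) :=
    Function.Embedding.nonempty_of_card_le (by simpa using hD)
  choose a ha using fun x => exists_enumeration ((A x).map φ) ((Finset.card_map φ).trans_le (hA x))
  choose b hb using fun x => exists_enumeration ((B x).map φ) ((Finset.card_map φ).trans_le (hB x))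
  refine ⟨(a, b), ?_⟩
  funext x y
  rw [Bool.eq_iff_iff, hf]
  simp only [incidence, decide_eq_true_eq, ← ha, ← hb]
  constructor
  · rintro ⟨u, hu, hv⟩
    obtain ⟨t, ht, rfl⟩ := Finset.mem_map.1 hu
    exact ⟨t, ht, (Finset.mem_map' φ).1 hv⟩
  · rintro ⟨t, ht, ht'⟩
    exact ⟨φ t, (Finset.mem_map' φ).2 ht, (Finset.mem_map' φ).2 ht'⟩

theorem mem_range_incidence_of_cleanCC_lt {n : ℕ} {f : (Fin n → Bool) → (Fin n → Bool) → Bool}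
    (hf : (cleanCC f : ℝ) < 2 * (n : ℝ) - 2 * Real.logb 2 ((n : ℝ) + 1) - 7) :
    f ∈ Set.range (incidence (X := Fin n → Bool) (K := 2 ^ n / (8 * (n + 1)))
      (D := 2 ^ (2 * n) - 1)) := by
  obtain ⟨k, l, P, hP, hcost⟩ := exists_protocol_cost_eq_cleanCC f
  obtain ⟨A, B, hA, hB, hAB⟩ := hP.exists_families
  rw [← hcost, P.cost_eq_add] at hf
  have hlog : 0 ≤ Real.logb 2 ((n : ℝ) + 1) :=
    Real.logb_nonneg (by norm_num) (by linarith [Nat.cast_nonneg (α := ℝ) n])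
  obtain ⟨q, hq⟩ : ∃ q, 2 * P.costBy q ≤ P.costBy .alice + P.costBy .bob := by
    rcases le_total (P.costBy .alice) (P.costBy .bob) with h | h
    · exact ⟨.alice, by omega⟩
    · exact ⟨.bob, by omega⟩
  -- Half of the cost bound is `n - log₂ (n + 1) - 7/2`; the factor 8 uses 3 of the 7/2.
  have hK : 2 ^ P.costBy q ≤ 2 ^ n / (8 * (n + 1)) := by
    rw [Nat.le_div_iff_mul_le (by positivity)]
    have hq' : (2 : ℝ) * P.costBy q ≤ ((P.costBy .alice + P.costBy .bob : ℕ) : ℝ) := by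
      exact_mod_cast hq
    have hn : (0 : ℝ) < (n : ℝ) + 1 := by positivity
    have : (2 : ℝ) ^ P.costBy q * (8 * (n + 1)) ≤ 2 ^ n := by
      calc (2 : ℝ) ^ P.costBy q * (8 * (n + 1))
          = (2 : ℝ) ^ ((P.costBy q : ℝ) + 3 + Real.logb 2 ((n : ℝ) + 1)) := by
            rw [Real.rpow_add (by norm_num), Real.rpow_add (by norm_num),
              Real.rpow_logb (by norm_num) (by norm_num) hn, Real.rpow_natCast]
            norm_num
            ring
        _ ≤ (2 : ℝ) ^ (n : ℝ) := Real.rpow_le_rpow_of_exponent_le (by norm_num) (by linarith)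
        _ = 2 ^ n := Real.rpow_natCast _ _
    exact_mod_cast this
  refine mem_range_incidence ?_ (fun x => (hA x q).trans hK) (fun x => (hB x q).trans hK) hAB
  have hc : P.costBy .alice + P.costBy .bob < 2 * n := by
    have : ((P.costBy .alice + P.costBy .bob : ℕ) : ℝ) < ((2 * n : ℕ) : ℝ) := by
      push_cast at hf ⊢
      linarith
    exact_mod_cast this
  rw [Fintype.card_prod, card_vector, card_vector, Fintype.card_bool, ← pow_add]
  exact Nat.le_sub_one_of_lt (Nat.pow_lt_pow_right (by norm_num) hc)

/-- With `2 ^ (2 * n) - 1` labels, each list entry has exactly `2 ^ (2 * n)` values including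
`none`. For `N = 2 ^ n` the exponents to compare are `4 * n * K * N + n` and `N * N`; each summand
on the left is at most half of `N * N`. -/
theorem card_codes_mul_le (n : ℕ) :
    Fintype.card (((Fin n → Bool) → Fin (2 ^ n / (8 * (n + 1))) → Option (Fin (2 ^ (2 * n) - 1))) ×
      ((Fin n → Bool) → Fin (2 ^ n / (8 * (n + 1))) → Option (Fin (2 ^ (2 * n) - 1)))) * 2 ^ n ≤
    Fintype.card ((Fin n → Bool) → (Fin n → Bool) → Bool) := by
  have h1 : 2 ^ (2 * n) - 1 + 1 = 2 ^ (2 * n) := Nat.sub_add_cancel Nat.one_le_two_pow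
  simp only [Fintype.card_prod, Fintype.card_fun, Fintype.card_option, Fintype.card_fin,
    Fintype.card_bool, h1, ← pow_mul, ← pow_add]
  refine Nat.pow_le_pow_right (by norm_num) ?_
  set K := 2 ^ n / (8 * (n + 1)) with hK
  have hK' : K * (8 * (n + 1)) ≤ 2 ^ n := Nat.div_mul_le_self _ _
  have hn : n < 2 ^ n := Nat.lt_two_pow_self
  rcases Nat.eq_zero_or_pos n with rfl | hpos
  · simp
  have h2 : 2 ≤ 2 ^ n := by simpa using Nat.pow_le_pow_right (n := 2) (by norm_num) hpos
  rw [pow_add]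
  generalize 2 ^ n = N at *
  have h3 : 8 * n * K ≤ N := by nlinarith
  have h4 : 8 * n * K * N ≤ N * N := Nat.mul_le_mul_right _ h3
  have h5 : 2 * N ≤ N * N := Nat.mul_le_mul_right _ h2
  nlinarith

theorem toOuterMeasure_cleanCC_lt_le (n : ℕ) :
    (PMF.uniformOfFintype ((Fin n → Bool) → (Fin n → Bool) → Bool)).toOuterMeasure
      {f | (cleanCC f : ℝ) ≥ 2 * (n : ℝ) - 2 * Real.logb 2 ((n : ℝ) + 1) - 7}ᶜ ≤
    (2⁻¹ : ENNReal) ^ n := by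
  classical
  rw [PMF.toOuterMeasure_uniformOfFintype_apply]
  set S := {f : (Fin n → Bool) → (Fin n → Bool) → Bool |
    (cleanCC f : ℝ) ≥ 2 * (n : ℝ) - 2 * Real.logb 2 ((n : ℝ) + 1) - 7}ᶜ
  have hS : S ⊆ Set.range (incidence (X := Fin n → Bool) (K := 2 ^ n / (8 * (n + 1)))
      (D := 2 ^ (2 * n) - 1)) :=
    fun f hf => mem_range_incidence_of_cleanCC_lt (not_le.1 hf)
  have hcard : Fintype.card S ≤ _ :=
    (Set.card_le_card hS).trans (Fintype.card_range_le _)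
  have h := (Nat.mul_le_mul_right (2 ^ n) hcard).trans (card_codes_mul_le n)
  rw [ENNReal.div_le_iff (by simp) (by simp), ← ENNReal.inv_pow,
    ← ENNReal.mul_le_iff_le_inv (by simp) (by simp), mul_comm]
  simpa only [Nat.cast_mul, Nat.cast_pow, Nat.cast_ofNat] using (Nat.cast_le (α := ENNReal)).2 h

end CleanComm

theorem theorem3 :
    Filter.Tendsto
      (fun n : ℕ =>
        (PMF.uniformOfFintype ((Fin n → Bool) → (Fin n → Bool) → Bool)).toOuterMeasure
          {f | (CleanComm.cleanCC f : ℝ) ≥ 2 * (n : ℝ) - 2 * Real.logb 2 ((n : ℝ) + 1) - 7})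
      Filter.atTop (nhds 1) := by
  have hone : ∀ n : ℕ,
      (PMF.uniformOfFintype ((Fin n → Bool) → (Fin n → Bool) → Bool)).toOuterMeasure Set.univ = 1 :=
    fun n => (PMF.toOuterMeasure_apply_eq_one_iff _ _).2 (Set.subset_univ _)
  have hlim : Filter.Tendsto (fun n : ℕ => 1 - (2⁻¹ : ENNReal) ^ n) Filter.atTop (nhds 1) := by
    have := ENNReal.Tendsto.sub (tendsto_const_nhds (x := (1 : ENNReal)))
      (ENNReal.tendsto_pow_atTop_nhds_zero_of_lt_one (r := 2⁻¹) (by simp))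
      (Or.inl ENNReal.one_ne_top)
    simpa using this
  refine tendsto_of_tendsto_of_tendsto_of_le_of_le hlim tendsto_const_nhds (fun n => ?_)
    fun n => (MeasureTheory.measure_mono (Set.subset_univ _)).trans_eq (hone n)
  refine tsub_le_iff_right.2 ?_
  -- Subadditivity on an event and its complement is enough, so no measurability is needed.
  rw [← hone n, ← Set.union_compl_self
    {f | (CleanComm.cleanCC f : ℝ) ≥ 2 * (n : ℝ) - 2 * Real.logb 2 ((n : ℝ) + 1) - 7}]
  exact (MeasureTheory.measure_union_le _ _).trans
    (by gcongr; exact CleanComm.toOuterMeasure_cleanCC_lt_le n)
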